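/- Let $n\ge 0$, let $S(n)$ be the space of real symmetric $n\times n$ matrices, $O(n)$ the group of orthogonal $n\times n$ matrices, and $\mathcal P(n)\subseteq O(n)$ the set of permutation matrices. For $Y\in S(n)$ let $\lambda(Y)=(\lambda_1(Y),\dots,\lambda_n(Y))^T\in\mathbb R^n$ be the vector of eigenvalues of $Y$ (with multiplicity) in increasing order, and let $\operatorname{diag}Y\in\mathbb R^n$ be the vector of diagonal entries of $Y$; for $y\in\mathbb R^n$ let $\operatorname{diag}y\in S(n)$ be the diagonal matrix with diagonal $y$. A subset $\mathcal E\subseteq S(n)$ is called symmetric if $\mathcal E=\{Q^TYQ : Y\in\mathcal E\}$ for all $Q\in O(n)$, and a subset $\varepsilon\subseteq\mathbb R^n$ is called symmetric if $\varepsilon=\{Py : y\in\varepsilon\}$ for all $P\in\mathcal P(n)$. A convex body is a nonempty, convex and compact set. The mapping $$\Phi(\mathcal E):=\{P\lambda(Y) : P\in\mathcal P(n),\ Y\in\mathcal E\}$$ is a bijection from the symmetric subsets of $S(n)$ onto the symmetric subsets of $\mathbb R^n$. Its inverse is $$\Phi^{-1}(\varepsilon)=\{Q(\operatorname{diag}y)Q^T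 : Q\in O(n),\ y\in\varepsilon\}.$$ Moreover, for every symmetric convex body $\mathcal K\subseteq S(n)$, $$\Phi(\mathcal K)=\{\operatorname{diag}Y : Y\in\mathcal K\},$$ and $\Phi$ restricts to a bijection from the symmetric convex bodies of $S(n)$ onto the symmetric convex bodies of $\mathbb R^n$. -/

import Mathlib

noncomputable section

namespace SymBody

/-- `S(n)`: the real vector space of symmetric `n × n` matrices, with the topology induced by
the entrywise topology on matrices. -/
def S (n : ℕ) : Submodule ℝ (Matrix (Fin n) (Fin n) ℝ) where
  carrier := {A | A.IsSymm}
  add_mem' := fun hA hB => Matrix.IsSymm.add hA hB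
  zero_mem' := Matrix.isSymm_zero
  smul_mem' := fun c _ hA => Matrix.IsSymm.smul hA c

variable {n : ℕ}

theorem S.isHermitian (Y : S n) : (Y : Matrix (Fin n) (Fin n) ℝ).IsHermitian :=
  (Matrix.conjTranspose_eq_transpose_of_trivial _).trans Y.2

/-- `λ(Y)`: the vector of eigenvalues of `Y`, with multiplicity, in increasing order. -/
def eig (Y : S n) : Fin n → ℝ :=
  (S.isHermitian Y).eigenvalues ∘ Tuple.sort (S.isHermitian Y).eigenvalues

theorem eig_monotone (Y : S n) : Monotone (eig Y) :=
  Tuple.monotone_sort _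

/-- `QᵀYQ` as an element of `S(n)`. -/
def conj (Q : Matrix (Fin n) (Fin n) ℝ) (Y : S n) : S n :=
  ⟨Q.transpose * (Y : Matrix (Fin n) (Fin n) ℝ) * Q, by
    have h : (Y : Matrix (Fin n) (Fin n) ℝ).transpose = Y := Y.2
    change (Q.transpose * (Y : Matrix (Fin n) (Fin n) ℝ) * Q).transpose = _
    simp [Matrix.transpose_mul, h, Matrix.mul_assoc]⟩

/-- `diag x`, the diagonal matrix with diagonal `x`, as an element of `S(n)`. -/
def diagMat (x : Fin n → ℝ) : S n :=
  ⟨Matrix.diagonal x, Matrix.isSymm_diagonal x⟩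

/-- `diag Y`, the vector of diagonal entries of `Y`. -/
def diagVec (Y : S n) : Fin n → ℝ :=
  (Y : Matrix (Fin n) (Fin n) ℝ).diag

/-- The set of `n × n` permutation matrices. -/
def permMatrices (n : ℕ) : Set (Matrix (Fin n) (Fin n) ℝ) :=
  Set.range fun σ : Equiv.Perm (Fin n) => σ.permMatrix ℝ

/-- The symmetric subsets of `S(n)`. -/
def symmMatSets (n : ℕ) : Set (Set (S n)) :=
  {E | ∀ Q ∈ Matrix.orthogonalGroup (Fin n) ℝ, E = {Z | ∃ Y ∈ E, Z = conj Q Y}}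

/-- The symmetric subsets of `ℝⁿ`. -/
def symmVecSets (n : ℕ) : Set (Set (Fin n → ℝ)) :=
  {e | ∀ P ∈ permMatrices n, e = {z | ∃ y ∈ e, z = P.mulVec y}}

/-- The convex bodies of `V`: the nonempty, convex and compact subsets. -/
def convexBodies (V : Type*) [TopologicalSpace V] [AddCommGroup V] [Module ℝ V] : Set (Set V) :=
  Set.range fun K : ConvexBody V => (K : Set V)

/-- `Φ(E) = {P λ(Y) | P a permutation matrix, Y ∈ E}`. -/
def Phi (E : Set (S n)) : Set (Fin n → ℝ) :=
  {z | ∃ P ∈ permMatrices n, ∃ Y ∈ E, z = P.mulVec (eig Y)}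

/-- `{Q (diag y) Qᵀ | Q ∈ O(n), y ∈ e}`. -/
def PhiInv (e : Set (Fin n → ℝ)) : Set (S n) :=
  {Z | ∃ Q ∈ Matrix.orthogonalGroup (Fin n) ℝ, ∃ y ∈ e, Z = conj Q.transpose (diagMat y)}

end SymBody

end

namespace SymBody

open Matrix

variable {n : ℕ}

/-! By the spectral theorem a symmetric set of matrices is determined by its diagonal members: `y ∈
Phi E` iff `diagMat y ∈ E` (`mem_Phi_iff`), and dually `Z ∈ PhiInv e` iff `eig Z ∈ e`
(`mem_PhiInv_iff`). This makes the two maps mutually inverse. Convexity rests on Schur's observation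
that the diagonal of `Q (diag y) Qᵀ` is `M y`, where `M` has entries `Q i j ^ 2` and is doubly
stochastic. By Birkhoff's theorem `M y` is a convex combination of rearrangements of `y`
(`diagVec_mem`). Hence `Phi K` is the set of diagonals of `K`, and `PhiInv e` is convex by
`mem_PhiInv_iff_diagVec_conj`. -/

/-- Equal multisets of values have the same sorted rearrangement; undo one sort with the other. -/
theorem exists_perm_of_map_univ_eq {α : Type*} [LinearOrder α] {x y : Fin n → α}
    (h : Finset.univ.val.map x = Finset.univ.val.map y) :
    ∃ σ : Equiv.Perm (Fin n), x = y ∘ σ := by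
  have hperm : (List.ofFn (x ∘ Tuple.sort x)).Perm (List.ofFn (y ∘ Tuple.sort y)) := by
    refine ((Equiv.Perm.ofFn_comp_perm _ x).trans ?_).trans (Equiv.Perm.ofFn_comp_perm _ y).symm
    rw [Fin.univ_val_map, Fin.univ_val_map] at h
    exact Multiset.coe_eq_coe.mp h
  have heq : x ∘ Tuple.sort x = y ∘ Tuple.sort y :=
    List.ofFn_injective (hperm.eq_of_sortedLE (Tuple.monotone_sort x).sortedLE_ofFn
      (Tuple.monotone_sort y).sortedLE_ofFn)
  refine ⟨(Tuple.sort x)⁻¹.trans (Tuple.sort y), funext fun i => ?_⟩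
  have := congrFun heq ((Tuple.sort x)⁻¹ i)
  simpa using this

theorem conj_mul (P Q : Matrix (Fin n) (Fin n) ℝ) (Y : S n) :
    conj (P * Q) Y = conj Q (conj P Y) := by
  apply Subtype.ext
  simp [conj, Matrix.mul_assoc]

theorem conj_one (Y : S n) : conj 1 Y = Y := by
  apply Subtype.ext
  simp [conj]

theorem conj_add (Q : Matrix (Fin n) (Fin n) ℝ) (Y Z : S n) :
    conj Q (Y + Z) = conj Q Y + conj Q Z := by
  apply Subtype.ext
  simp [conj, Matrix.mul_add, Matrix.add_mul]

theorem conj_smul (Q : Matrix (Fin n) (Fin n) ℝ) (c : ℝ) (Y : S n) :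
    conj Q (c • Y) = c • conj Q Y := by
  apply Subtype.ext
  simp [conj]

theorem diagVec_diagMat (y : Fin n → ℝ) : diagVec (diagMat y) = y := by
  simp [diagVec, diagMat]

theorem transpose_mem_orthogonalGroup {Q : Matrix (Fin n) (Fin n) ℝ}
    (hQ : Q ∈ orthogonalGroup (Fin n) ℝ) : Qᵀ ∈ orthogonalGroup (Fin n) ℝ := by
  rw [mem_orthogonalGroup_iff, transpose_transpose]
  exact (mem_orthogonalGroup_iff' _ _).mp hQ

theorem permMatrix_mem_orthogonalGroup (σ : Equiv.Perm (Fin n)) :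
    σ.permMatrix ℝ ∈ orthogonalGroup (Fin n) ℝ := by
  rw [mem_orthogonalGroup_iff, transpose_permMatrix, ← permMatrix_mul, inv_mul_cancel,
    permMatrix_one]

theorem conj_permMatrix_transpose_diagMat (σ : Equiv.Perm (Fin n)) (y : Fin n → ℝ) :
    conj (σ.permMatrix ℝ)ᵀ (diagMat y) = diagMat (y ∘ σ) := by
  apply Subtype.ext
  simp only [conj, diagMat, transpose_transpose]
  rw [transpose_permMatrix]
  ext i j
  rw [PEquiv.toMatrix_toPEquiv_mul, PEquiv.mul_toMatrix_toPEquiv]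
  simp [diagonal_apply, Equiv.Perm.inv_def]

theorem mem_symmMatSets_iff {E : Set (S n)} :
    E ∈ symmMatSets n ↔ ∀ Q ∈ orthogonalGroup (Fin n) ℝ, ∀ Y ∈ E, conj Q Y ∈ E := by
  refine ⟨fun h Q hQ Y hY => ?_, fun h Q hQ => Set.Subset.antisymm (fun Z hZ => ?_) ?_⟩
  · rw [h Q hQ]
    exact ⟨Y, hY, rfl⟩
  · refine ⟨conj Qᵀ Z, h _ (transpose_mem_orthogonalGroup hQ) Z hZ, ?_⟩
    rw [← conj_mul, (mem_orthogonalGroup_iff' _ _).mp hQ, conj_one]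
  · rintro _ ⟨Y, hY, rfl⟩
    exact h Q hQ Y hY

theorem mem_symmVecSets_iff {e : Set (Fin n → ℝ)} :
    e ∈ symmVecSets n ↔ ∀ σ : Equiv.Perm (Fin n), ∀ y ∈ e, y ∘ σ ∈ e := by
  refine ⟨fun h σ y hy => ?_, ?_⟩
  · rw [h _ ⟨σ, rfl⟩]
    exact ⟨y, hy, (permMatrix_mulVec _).symm⟩
  · rintro h _ ⟨σ, rfl⟩
    refine Set.Subset.antisymm (fun z hz => ?_) ?_
    · refine ⟨z ∘ ⇑σ⁻¹, h _ z hz, ?_⟩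
      rw [permMatrix_mulVec]
      ext i
      simp
    · rintro _ ⟨y, hy, rfl⟩
      rw [permMatrix_mulVec]
      exact h σ y hy

/-! ### Diagonalization and the inverse bijections -/

theorem mem_Phi_iff_exists_perm {E : Set (S n)} {z : Fin n → ℝ} :
    z ∈ Phi E ↔ ∃ σ : Equiv.Perm (Fin n), ∃ Y ∈ E, z = eig Y ∘ σ := by
  constructor
  · rintro ⟨_, ⟨σ, rfl⟩, Y, hY, rfl⟩
    exact ⟨σ, Y, hY, permMatrix_mulVec _⟩
  · rintro ⟨σ, Y, hY, rfl⟩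
    exact ⟨_, ⟨σ, rfl⟩, Y, hY, (permMatrix_mulVec _).symm⟩

theorem exists_eq_conj_diagMat_eig (Y : S n) :
    ∃ Q ∈ orthogonalGroup (Fin n) ℝ, Y = conj Qᵀ (diagMat (eig Y)) := by
  set U := (S.isHermitian Y).eigenvectorUnitary.1
  set σ := Tuple.sort (S.isHermitian Y).eigenvalues
  have hUmem : U ∈ orthogonalGroup (Fin n) ℝ := (S.isHermitian Y).eigenvectorUnitary.2
  -- The permutation factor reorders the eigenvector columns to match the sorted eigenvalues.
  refine ⟨U * (σ.permMatrix ℝ)ᵀ,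
    mul_mem hUmem (transpose_mem_orthogonalGroup (permMatrix_mem_orthogonalGroup σ)), ?_⟩
  have h1 : Y = conj Uᵀ (diagMat (S.isHermitian Y).eigenvalues) := by
    apply Subtype.ext
    have h := (S.isHermitian Y).spectral_theorem
    rw [Unitary.conjStarAlgAut_apply] at h
    simp only [conj, diagMat, transpose_transpose]
    exact h
  rw [transpose_mul, transpose_transpose, conj_mul]
  have h2 : eig Y = (S.isHermitian Y).eigenvalues ∘ σ := rfl
  rw [h2, ← conj_permMatrix_transpose_diagMat, ← conj_mul, ← conj_mul,
    ← mul_assoc, (mem_orthogonalGroup_iff' _ _).mp (permMatrix_mem_orthogonalGroup σ), one_mul]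
  exact h1

/-- Orthogonal conjugation preserves the characteristic polynomial, whose roots with multiplicity
are the entries of `y`. -/
theorem exists_eig_conj_diagMat {Q : Matrix (Fin n) (Fin n) ℝ}
    (hQ : Q ∈ orthogonalGroup (Fin n) ℝ) (y : Fin n → ℝ) :
    ∃ σ : Equiv.Perm (Fin n), eig (conj Q (diagMat y)) = y ∘ σ := by
  set Z := conj Q (diagMat y)
  have hchar : (Z : Matrix (Fin n) (Fin n) ℝ).charpoly = (diagonal y).charpoly := by
    change (Qᵀ * diagonal y * Q).charpoly = _
    rw [charpoly_mul_comm, ← mul_assoc, (mem_orthogonalGroup_iff _ _).mp hQ, one_mul]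
  have hroots := (S.isHermitian Z).roots_charpoly_eq_eigenvalues
  rw [hchar, charpoly_diagonal, Polynomial.roots_prod _ _
    (Finset.prod_ne_zero_iff.mpr fun i _ => Polynomial.X_sub_C_ne_zero _)] at hroots
  obtain ⟨τ, hτ⟩ := exists_perm_of_map_univ_eq (x := (S.isHermitian Z).eigenvalues) (y := y)
    (by simpa [Function.comp_def] using hroots.symm)
  refine ⟨(Tuple.sort (S.isHermitian Z).eigenvalues).trans τ, ?_⟩
  rw [eig]
  nth_rw 1 [hτ]
  rfl

theorem mem_Phi_iff {E : Set (S n)} (hE : E ∈ symmMatSets n) {y : Fin n → ℝ} :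
    y ∈ Phi E ↔ diagMat y ∈ E := by
  rw [mem_symmMatSets_iff] at hE
  rw [mem_Phi_iff_exists_perm]
  constructor
  · rintro ⟨σ, Y, hY, rfl⟩
    obtain ⟨Q, hQ, h⟩ := exists_eq_conj_diagMat_eig Y
    have h' : diagMat (eig Y) = conj Q Y := by
      conv_rhs => rw [h]
      rw [← conj_mul, (mem_orthogonalGroup_iff' _ _).mp hQ, conj_one]
    rw [← conj_permMatrix_transpose_diagMat, h']
    exact hE _ (transpose_mem_orthogonalGroup (permMatrix_mem_orthogonalGroup σ)) _ (hE _ hQ _ hY)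
  · intro hy
    obtain ⟨σ, hσ⟩ := exists_eig_conj_diagMat (one_mem (orthogonalGroup (Fin n) ℝ)) y
    rw [conj_one] at hσ
    refine ⟨σ⁻¹, _, hy, ?_⟩
    rw [hσ]
    ext i
    simp

theorem mem_PhiInv_iff {e : Set (Fin n → ℝ)} (he : e ∈ symmVecSets n) {Z : S n} :
    Z ∈ PhiInv e ↔ eig Z ∈ e := by
  constructor
  · rintro ⟨Q, hQ, y, hy, rfl⟩
    obtain ⟨σ, hσ⟩ := exists_eig_conj_diagMat (transpose_mem_orthogonalGroup hQ) y
    rw [hσ]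
    exact mem_symmVecSets_iff.mp he σ y hy
  · intro hZ
    obtain ⟨Q, hQ, h⟩ := exists_eq_conj_diagMat_eig Z
    exact ⟨Q, hQ, _, hZ, h⟩

theorem Phi_mem_symmVecSets (E : Set (S n)) : Phi E ∈ symmVecSets n := by
  rw [mem_symmVecSets_iff]
  intro σ y hy
  rw [mem_Phi_iff_exists_perm] at hy ⊢
  obtain ⟨τ, Y, hY, rfl⟩ := hy
  exact ⟨σ.trans τ, Y, hY, rfl⟩

theorem PhiInv_mem_symmMatSets (e : Set (Fin n → ℝ)) : PhiInv e ∈ symmMatSets n := by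
  rw [mem_symmMatSets_iff]
  rintro P hP _ ⟨Q, hQ, y, hy, rfl⟩
  refine ⟨Pᵀ * Q, mul_mem (transpose_mem_orthogonalGroup hP) hQ, y, hy, ?_⟩
  rw [← conj_mul, transpose_mul, transpose_transpose]

theorem diagMat_mem_PhiInv_iff {e : Set (Fin n → ℝ)} (he : e ∈ symmVecSets n) {y : Fin n → ℝ} :
    diagMat y ∈ PhiInv e ↔ y ∈ e := by
  rw [mem_PhiInv_iff he]
  obtain ⟨σ, hσ⟩ := exists_eig_conj_diagMat (one_mem (orthogonalGroup (Fin n) ℝ)) y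
  rw [conj_one] at hσ
  rw [hσ]
  refine ⟨fun h => ?_, mem_symmVecSets_iff.mp he σ y⟩
  have h' := mem_symmVecSets_iff.mp he σ⁻¹ _ h
  rwa [show (y ∘ σ) ∘ ⇑σ⁻¹ = y by ext i; simp] at h'

theorem invOn_PhiInv_Phi :
    Set.InvOn (PhiInv (n := n)) (Phi (n := n)) (symmMatSets n) (symmVecSets n) := by
  constructor
  · intro E hE
    ext Z
    rw [mem_PhiInv_iff (Phi_mem_symmVecSets E), mem_Phi_iff hE]
    obtain ⟨Q, hQ, h⟩ := exists_eq_conj_diagMat_eig Z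
    have hE' := mem_symmMatSets_iff.mp hE
    constructor
    · intro hZ
      rw [h]
      exact hE' _ (transpose_mem_orthogonalGroup hQ) _ hZ
    · intro hZ
      have h' := hE' Q hQ Z hZ
      rwa [h, ← conj_mul, (mem_orthogonalGroup_iff' _ _).mp hQ, conj_one] at h'
  · intro e he
    ext y
    rw [mem_Phi_iff (PhiInv_mem_symmMatSets e), diagMat_mem_PhiInv_iff he]

/-! ### Diagonals, Birkhoff's theorem and convexity -/

theorem entrywise_sq_mem_doublyStochastic {Q : Matrix (Fin n) (Fin n) ℝ}
    (hQ : Q ∈ orthogonalGroup (Fin n) ℝ) :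
    (of fun i j => Q i j ^ 2) ∈ doublyStochastic ℝ (Fin n) := by
  rw [mem_doublyStochastic_iff_sum]
  refine ⟨fun i j => sq_nonneg _, fun i => ?_, fun j => ?_⟩
  · have h := congrFun (congrFun ((mem_orthogonalGroup_iff _ _).mp hQ) i) i
    simpa [mul_apply, sq] using h
  · have h := congrFun (congrFun ((mem_orthogonalGroup_iff' _ _).mp hQ) j) j
    simpa [mul_apply, sq] using h

theorem diagVec_conj_transpose_diagMat (Q : Matrix (Fin n) (Fin n) ℝ) (y : Fin n → ℝ) :
    diagVec (conj Qᵀ (diagMat y)) = (of fun i j => Q i j ^ 2) *ᵥ y := by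
  ext i
  simp only [diagVec, conj, diagMat, transpose_transpose, diag_apply, mulVec, dotProduct, of_apply]
  rw [mul_apply]
  simp only [mul_diagonal, transpose_apply]
  exact Finset.sum_congr rfl fun j _ => by ring

theorem mulVec_mem_of_doublyStochastic {e : Set (Fin n → ℝ)} (he : e ∈ symmVecSets n)
    (hconv : Convex ℝ e) {M : Matrix (Fin n) (Fin n) ℝ} (hM : M ∈ doublyStochastic ℝ (Fin n))
    {y : Fin n → ℝ} (hy : y ∈ e) : M *ᵥ y ∈ e := by
  obtain ⟨w, hw0, hw1, rfl⟩ := exists_eq_sum_perm_of_mem_doublyStochastic hM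
  rw [sum_mulVec]
  simp only [smul_mulVec, permMatrix_mulVec]
  exact hconv.sum_mem (fun σ _ => hw0 σ) hw1 fun σ _ => mem_symmVecSets_iff.mp he σ y hy

theorem diagVec_mem {e : Set (Fin n → ℝ)} (he : e ∈ symmVecSets n)
    (hconv : Convex ℝ e) {Z : S n} (hZ : Z ∈ PhiInv e) : diagVec Z ∈ e := by
  obtain ⟨Q, hQ, y, hy, rfl⟩ := hZ
  rw [diagVec_conj_transpose_diagMat]
  exact mulVec_mem_of_doublyStochastic he hconv (entrywise_sq_mem_doublyStochastic hQ) hy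

theorem convex_Phi {E : Set (S n)} (hE : E ∈ symmMatSets n) (hconv : Convex ℝ E) :
    Convex ℝ (Phi E) := by
  intro x hx y hy a b ha hb hab
  rw [mem_Phi_iff hE] at *
  have h : diagMat (a • x + b • y) = a • diagMat x + b • diagMat y := by
    apply Subtype.ext
    change diagonal (a • x + b • y) = a • diagonal x + b • diagonal y
    rw [← diagonal_smul, ← diagonal_smul, diagonal_add]
    rfl
  rw [h]
  exact hconv hx hy ha hb hab

theorem Phi_eq_image_diagVec {K : Set (S n)} (hK : K ∈ symmMatSets n) (hconv : Convex ℝ K) :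
    Phi K = diagVec '' K := by
  ext y
  constructor
  · intro hy
    exact ⟨_, (mem_Phi_iff hK).mp hy, diagVec_diagMat y⟩
  · rintro ⟨Y, hY, rfl⟩
    refine diagVec_mem (Phi_mem_symmVecSets K) (convex_Phi hK hconv) ?_
    rwa [invOn_PhiInv_Phi.1 hK]

/-- Exhibits `PhiInv e` as an intersection of preimages of `e` under linear maps, hence convex. The
converse needs only a `Q` that diagonalizes `Z`. -/
theorem mem_PhiInv_iff_diagVec_conj {e : Set (Fin n → ℝ)} (he : e ∈ symmVecSets n)
    (hconv : Convex ℝ e) {Z : S n} :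
    Z ∈ PhiInv e ↔ ∀ Q ∈ orthogonalGroup (Fin n) ℝ, diagVec (conj Q Z) ∈ e := by
  constructor
  · intro hZ Q hQ
    exact diagVec_mem he hconv (mem_symmMatSets_iff.mp (PhiInv_mem_symmMatSets e) Q hQ Z hZ)
  · intro h
    obtain ⟨Q, hQ, hZ⟩ := exists_eq_conj_diagMat_eig Z
    have h' := h Q hQ
    rw [hZ, ← conj_mul, (mem_orthogonalGroup_iff' _ _).mp hQ, conj_one, diagVec_diagMat] at h'
    exact (mem_PhiInv_iff he).mpr h'

theorem convex_PhiInv {e : Set (Fin n → ℝ)} (he : e ∈ symmVecSets n) (hconv : Convex ℝ e) :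
    Convex ℝ (PhiInv e) := by
  intro Y hY Z hZ a b ha hb hab
  rw [mem_PhiInv_iff_diagVec_conj he hconv] at *
  intro Q hQ
  have h : diagVec (conj Q (a • Y + b • Z)) =
      a • diagVec (conj Q Y) + b • diagVec (conj Q Z) := by
    rw [conj_add, conj_smul, conj_smul]
    rfl
  rw [h]
  exact hconv (hY Q hQ) (hZ Q hQ) ha hb hab

/-! ### Compactness and convex bodies -/

theorem isCompact_orthogonalGroup :
    IsCompact (orthogonalGroup (Fin n) ℝ : Set (Matrix (Fin n) (Fin n) ℝ)) := by
  have hbox : IsCompact (Set.univ.pi fun _ : Fin n => Set.univ.pi fun _ : Fin n =>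
      Set.Icc (-1 : ℝ) 1) :=
    isCompact_univ_pi fun _ => isCompact_univ_pi fun _ => isCompact_Icc
  refine hbox.of_isClosed_subset ?_ fun Q hQ i _ j _ => ?_
  · have h : (orthogonalGroup (Fin n) ℝ : Set (Matrix (Fin n) (Fin n) ℝ)) =
        {Q | Q * Qᵀ = 1} := by
      ext Q
      exact mem_orthogonalGroup_iff _ _
    rw [h]
    exact isClosed_eq (by fun_prop) continuous_const
  · exact abs_le.mp (entry_norm_bound_of_unitary hQ i j)

theorem isCompact_PhiInv {e : Set (Fin n → ℝ)} (he : IsCompact e) : IsCompact (PhiInv e) := by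
  have h : PhiInv e = (fun p : Matrix (Fin n) (Fin n) ℝ × (Fin n → ℝ) =>
      conj p.1ᵀ (diagMat p.2)) '' ((orthogonalGroup (Fin n) ℝ : Set _) ×ˢ e) := by
    ext Z
    constructor
    · rintro ⟨Q, hQ, y, hy, rfl⟩
      exact ⟨(Q, y), ⟨hQ, hy⟩, rfl⟩
    · rintro ⟨⟨Q, y⟩, ⟨hQ, hy⟩, rfl⟩
      exact ⟨Q, hQ, y, hy, rfl⟩
  rw [h]
  refine (isCompact_orthogonalGroup.prod he).image ?_
  refine Continuous.subtype_mk ?_ _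
  simp only [diagMat, transpose_transpose]
  fun_prop

theorem mem_convexBodies_iff {V : Type*} [TopologicalSpace V] [AddCommGroup V] [Module ℝ V]
    {K : Set V} : K ∈ convexBodies V ↔ Convex ℝ K ∧ IsCompact K ∧ K.Nonempty := by
  constructor
  · rintro ⟨K, rfl⟩
    exact ⟨K.convex, K.isCompact, K.nonempty⟩
  · rintro ⟨h1, h2, h3⟩
    exact ⟨⟨K, h1, h2, h3⟩, rfl⟩

/-- Describing `Phi K` by the continuous map `diagVec` gives compactness without proving that `eig`
is continuous. -/
theorem Phi_mem_convexBodies {K : Set (S n)} (hK : K ∈ symmMatSets n)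
    (hbody : K ∈ convexBodies (S n)) : Phi K ∈ convexBodies (Fin n → ℝ) := by
  rw [mem_convexBodies_iff] at hbody ⊢
  obtain ⟨hconv, hcomp, hne⟩ := hbody
  refine ⟨convex_Phi hK hconv, ?_, ?_⟩
  · rw [Phi_eq_image_diagVec hK hconv]
    exact hcomp.image continuous_subtype_val.matrix_diag
  · rw [Phi_eq_image_diagVec hK hconv]
    exact hne.image _

theorem PhiInv_mem_convexBodies {e : Set (Fin n → ℝ)} (he : e ∈ symmVecSets n)
    (hbody : e ∈ convexBodies (Fin n → ℝ)) : PhiInv e ∈ convexBodies (S n) := by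
  rw [mem_convexBodies_iff] at hbody ⊢
  obtain ⟨hconv, hcomp, y, hy⟩ := hbody
  exact ⟨convex_PhiInv he hconv, isCompact_PhiInv hcomp, _, (diagMat_mem_PhiInv_iff he).mpr hy⟩

end SymBody

theorem mainTheorem11 (n : ℕ) :
    Set.BijOn (SymBody.Phi (n := n)) (SymBody.symmMatSets n) (SymBody.symmVecSets n) ∧
    Set.InvOn (SymBody.PhiInv (n := n)) (SymBody.Phi (n := n))
      (SymBody.symmMatSets n) (SymBody.symmVecSets n) ∧
    (∀ K ∈ SymBody.symmMatSets n ∩ SymBody.convexBodies (SymBody.S n),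
      SymBody.Phi K = {y | ∃ Y ∈ K, y = SymBody.diagVec Y}) ∧
    Set.BijOn (SymBody.Phi (n := n))
      (SymBody.symmMatSets n ∩ SymBody.convexBodies (SymBody.S n))
      (SymBody.symmVecSets n ∩ SymBody.convexBodies (Fin n → ℝ)) := by
  refine ⟨SymBody.invOn_PhiInv_Phi.bijOn (fun E _ => SymBody.Phi_mem_symmVecSets E)
    (fun e _ => SymBody.PhiInv_mem_symmMatSets e), SymBody.invOn_PhiInv_Phi, ?_, ?_⟩
  · rintro K ⟨hK, hbody⟩
    rw [SymBody.Phi_eq_image_diagVec hK (SymBody.mem_convexBodies_iff.mp hbody).1]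
    ext y
    exact exists_congr fun Y => and_congr_right fun _ => eq_comm
  · exact (SymBody.invOn_PhiInv_Phi.mono Set.inter_subset_left Set.inter_subset_left).bijOn
      (fun K hK => ⟨SymBody.Phi_mem_symmVecSets K, SymBody.Phi_mem_convexBodies hK.1 hK.2⟩)
      (fun e he => ⟨SymBody.PhiInv_mem_symmMatSets e, SymBody.PhiInv_mem_convexBodies he.1 he.2⟩)
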